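/- Fix a set $A$ of actions. The equational theory $\mathrm{CSP}(|,\Omega)$ has as signature a binary operation $\sqcap$ and, for every $n\ge 0$ and every sequence $\vec a=a_1,\dots,a_n$ of pairwise distinct actions, two $n$-ary operations $\square_{\vec a}$ and $\square^{\Omega}_{\vec a}$, written $\square_{i=1}^n a_i t_i$ and $\Omega\,\square\,\square_{i=1}^n a_i t_i$; write $\Omega$ for the $0$-ary operation $\square^{\Omega}_{()}$, and $t\sqsubseteq u$ for $t\sqcap u=t$. Its axioms are: (1) $\sqcap$ is associative, commutative and idempotent, and $x\sqcap\Omega=x$; (2) $\square_{\vec a}$ and $\square^{\Omega}_{\vec a}$ are commutative: $\square_i a_ix_i=\square_i a_{\pi(i)}x_{\pi(i)}$ for every permutation $\pi$ of $\{1,\dots,n\}$, and likewise with the $\Omega$-summand; (3) both distribute over $\sqcap$: for distinct $a_1,\dots,a_n$ with $n\ge1$, $$a_1(x\sqcap x')\,\square\,\square_{i=2}^n a_ix_i=\Bigl(a_1x\,\square\,\square_{i=2}^n a_ix_i\Bigr)\sqcap\Bigl(a_1x'\,\square\,\square_{i=2}^n a_ix_i\Bigr),$$ and likewise with the $\Omega$-summand;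 (4) for arbitrary finite sequences of actions $a_i$ (of length $\ge 0$) and $b_1,\dots,b_n$ ($n\ge1$), possibly with repetitions, $$\Bigl(\Omega\,\square\,\square_i a_ix_i\Bigr)\sqcap\Bigl(\Omega\,\square\,\square_{j=1}^n b_jy_j\Bigr)\sqsubseteq \Omega\,\square\, b_1y_1\,\square\,\square_i a_ix_i,$$ $$\Bigl(\Omega\,\square\,\square_i a_ix_i\Bigr)\sqcap\Bigl(\square_{j=1}^n b_jy_j\Bigr)\sqsubseteq \Omega\,\square\, b_1y_1\,\square\,\square_i a_ix_i,$$ $$\Bigl(\square_i a_ix_i\Bigr)\sqcap\Bigl(\Omega\,\square\,\square_{j=1}^n b_jy_j\Bigr)\sqsubseteq b_1y_1\,\square\,\square_i a_ix_i,$$ $$\Bigl(\square_i a_ix_i\Bigr)\sqcap\Bigl(\square_{j=1}^n b_jy_j\Bigr)\sqsubseteq b_1y_1\,\square\,\square_i a_ix_i,$$ where a choice $\square_i a_it_i$ with repeated actions abbreviates $\square_{b\in\{a_1,\dots,a_n\}}\, b\,\bigl(\bigsqcap_{a_i=b}t_i\bigr)$, and likewise with the $\Omega$-summand. Let $X$ be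 a set. An $X$-trace is a pair $(w,x)$, written $wx$, with $w\in A^*$ and $x\in X$. An $X$-process is a pair $P=(T_P,F_P)$, where $T_P$ is a set of traces $w\in A^*$ and of $X$-traces and $F_P$ is a set of failure pairs $(w,W)$ with $w\in A^*$, $W\subseteq A$ ($W$ may be infinite), such that: $\varepsilon\in T_P$; $wa\in T_P\Rightarrow w\in T_P$ for $a\in A$; $wx\in T_P\Rightarrow w\in T_P$ for $x\in X$; $(w,W)\in F_P\Rightarrow w\in T_P$; $(w,W)\in F_P$ and $V\subseteq W$ imply $(w,V)\in F_P$; and, for $V\subseteq A$, $(w,W)\in F_P$ and $wa\notin T_P$ for all $a\in V$ imply $(w,W\cup V)\in F_P$. It is finitary if $T_P$ is finite. Let $\mathcal F_{df}(X)$ be the set of finitary $X$-processes with the operations $P\sqcap Q=(T_P\cup T_Q,\;F_P\cup F_Q)$, $$\square^{\Omega}_{\vec a}(P_1,\dots,P_n)=\bigl(\{\varepsilon\}\cup\{a_iu\mid u\in T_{P_i}\},\;\{(a_iw,W)\mid (w,W)\in F_{P_i}\}\bigr),$$ where $u$ ranges over traces and $X$-traces, and $\square_{\vec a}(P_1,\dots,P_n)$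 having the same first component and second component $$\{(\varepsilon,W)\mid W\cap\{a_1,\dots,a_n\}=\emptyset\}\cup\{(a_iw,W)\mid (w,W)\in F_{P_i}\}.$$ **Theorem.** For all sets $A$ and $X$, $\mathcal F_{df}(X)$ is the free $\mathrm{CSP}(|,\Omega)$-algebra over $X$, with unit $\eta(x)=(\{\varepsilon,x\},\emptyset)$. That is, $\mathcal F_{df}(X)$ satisfies all the axioms of $\mathrm{CSP}(|,\Omega)$, and for every $\mathrm{CSP}(|,\Omega)$-algebra $B$ and every map $f:X\to B$ there is exactly one homomorphism $h:\mathcal F_{df}(X)\to B$ with $h(\eta(x))=f(x)$ for all $x\in X$. -/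

import Mathlib

namespace CSP

universe u v w

/-! ## The equational theory of internal choice and deterministic external choice

A *guarded list* `[(a₁, t₁), …, (aₙ, tₙ)]` presents the sequence of actions `a₁, …, aₙ` together
with the arguments `t₁, …, tₙ`; the action sequence is *deterministic* if the `aᵢ` are pairwise
distinct. -/

/-- The action sequence of a guarded list has no repetitions. -/
def Deterministic {A : Type u} {B : Type v} (l : List (A × B)) : Prop :=
  (l.map Prod.fst).Nodup

theorem deterministic_nil {A : Type u} {B : Type v} : Deterministic ([] : List (A × B)) :=
  List.nodup_nil

/-- Algebras for the signature with a binary operation `⊓` (here `inf`, internal choice) and, for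
every sequence `a₁, …, aₙ` (`n ≥ 0`) of pairwise distinct actions, two `n`-ary operations:
deterministic external choice `□_{a₁…aₙ}` and deterministic external choice with a divergent summand
`□^Ω_{a₁…aₙ}`. The value of `□_{a₁…aₙ}` at `(t₁, …, tₙ)` is `det [(a₁, t₁), …, (aₙ, tₙ)] _`, and
similarly for `□^Ω_{a₁…aₙ}` and `detOmega`. No laws are imposed here. -/
class Ops (A : outParam (Type u)) (B : Type v) where
  inf : B → B → B
  det : (l : List (A × B)) → Deterministic l → B
  detOmega : (l : List (A × B)) → Deterministic l → B

section Notions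

variable {A : Type u} {B : Type v} [Ops A B]

/-- The constant `Ω`, which is the `0`-ary case of `□^Ω`. -/
def omega : B := Ops.detOmega (A := A) [] deterministic_nil

/-- `t ⊑ u` abbreviates `t ⊓ u = t`. -/
def Refines (t u : B) : Prop := Ops.inf t u = t

/-- `t₁ ⊓ ⋯ ⊓ tₙ`, parenthesised to the left, for `n ≥ 1`. (The value at the empty list plays no
role, since only nonempty lists are used below.) -/
def infs : List B → B
  | [] => omega
  | t :: ts => ts.foldl Ops.inf t

open Classical in
/-- The guarded list of the pairs `(b, ⊓_{aᵢ = b} tᵢ)`, for `b` in `{a₁, …, aₙ}` without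
repetitions. -/
noncomputable def merge (l : List (A × B)) : List (A × B) :=
  (l.map Prod.fst).dedup.map fun b => (b, infs ((l.filter fun p => p.1 = b).map Prod.snd))

theorem deterministic_merge (l : List (A × B)) : Deterministic (merge l) := by
  classical
  have h : (merge l).map Prod.fst = (l.map Prod.fst).dedup := by
    simp only [merge, List.map_map]
    exact List.map_id _
  unfold Deterministic
  rw [h]
  exact List.nodup_dedup _

/-- The possibly nondeterministic external choice `□ᵢ aᵢ tᵢ`, where the `aᵢ` need not be distinct:
it abbreviates `□_{b ∈ {a₁, …, aₙ}} b (⊓_{aᵢ = b} tᵢ)`. -/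
noncomputable def choice (l : List (A × B)) : B := Ops.det (merge l) (deterministic_merge l)

/-- The possibly nondeterministic external choice `Ω □ □ᵢ aᵢ tᵢ`, with the same convention. -/
noncomputable def choiceOmega (l : List (A × B)) : B :=
  Ops.detOmega (merge l) (deterministic_merge l)

end Notions

/-- `CSP(|,Ω)`-algebras: the axioms of the equational theory `CSP(|,Ω)` over the alphabet `A`. -/
class IsAlgebra (A : Type u) (B : Type v) [Ops A B] : Prop where
  inf_assoc (x y z : B) : Ops.inf (Ops.inf x y) z = Ops.inf x (Ops.inf y z)
  inf_comm (x y : B) : Ops.inf x y = Ops.inf y x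
  inf_idem (x : B) : Ops.inf x x = x
  inf_omega (x : B) : Ops.inf x omega = x
  /-- Commutativity of deterministic external choice. -/
  det_perm (l m : List (A × B)) (hl : Deterministic l) (hm : Deterministic m) (h : l.Perm m) :
    Ops.det l hl = Ops.det m hm
  detOmega_perm (l m : List (A × B)) (hl : Deterministic l) (hm : Deterministic m)
    (h : l.Perm m) : Ops.detOmega l hl = Ops.detOmega m hm
  /-- Deterministic external choice distributes over internal choice. -/
  det_inf (a : A) (x y : B) (l : List (A × B)) (h : Deterministic ((a, Ops.inf x y) :: l))
    (hx : Deterministic ((a, x) :: l)) (hy : Deterministic ((a, y) :: l)) :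
    Ops.det ((a, Ops.inf x y) :: l) h =
      Ops.inf (Ops.det ((a, x) :: l) hx) (Ops.det ((a, y) :: l) hy)
  detOmega_inf (a : A) (x y : B) (l : List (A × B)) (h : Deterministic ((a, Ops.inf x y) :: l))
    (hx : Deterministic ((a, x) :: l)) (hy : Deterministic ((a, y) :: l)) :
    Ops.detOmega ((a, Ops.inf x y) :: l) h =
      Ops.inf (Ops.detOmega ((a, x) :: l) hx) (Ops.detOmega ((a, y) :: l) hy)
  /-- `(Ω □ □ᵢ aᵢ xᵢ) ⊓ (Ω □ b₁ y₁ □ □ⱼ bⱼ yⱼ) ⊑ Ω □ b₁ y₁ □ □ᵢ aᵢ xᵢ`, and then the variants of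
  this axiom with `Ω` absent from one or both of the external choices on the left. -/
  absorb_omega_omega (l m : List (A × B)) (b : A) (y : B) :
    Refines (Ops.inf (choiceOmega l) (choiceOmega ((b, y) :: m))) (choiceOmega ((b, y) :: l))
  absorb_omega_det (l m : List (A × B)) (b : A) (y : B) :
    Refines (Ops.inf (choiceOmega l) (choice ((b, y) :: m))) (choiceOmega ((b, y) :: l))
  absorb_det_omega (l m : List (A × B)) (b : A) (y : B) :
    Refines (Ops.inf (choice l) (choiceOmega ((b, y) :: m))) (choice ((b, y) :: l))
  absorb_det_det (l m : List (A × B)) (b : A) (y : B) :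
    Refines (Ops.inf (choice l) (choice ((b, y) :: m))) (choice ((b, y) :: l))

/-- Applying a map to all the arguments in a guarded list. -/
def mapArgs {A : Type u} {B : Type v} {C : Type w} (h : B → C) (l : List (A × B)) :
    List (A × C) :=
  l.map fun p => (p.1, h p.2)

theorem Deterministic.mapArgs {A : Type u} {B : Type v} {C : Type w} {l : List (A × B)}
    (hl : Deterministic l) (h : B → C) : Deterministic (mapArgs h l) := by
  simpa [Deterministic, CSP.mapArgs, Function.comp_def] using hl

/-- Homomorphisms: maps respecting all the operations. -/
structure IsHom {A : Type u} {B : Type v} {C : Type w} [Ops A B] [Ops A C] (h : B → C) :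
    Prop where
  map_inf (x y : B) : h (Ops.inf x y) = Ops.inf (h x) (h y)
  map_det (l : List (A × B)) (hl : Deterministic l) :
    h (Ops.det l hl) = Ops.det (mapArgs h l) (hl.mapArgs h)
  map_detOmega (l : List (A × B)) (hl : Deterministic l) :
    h (Ops.detOmega l hl) = Ops.detOmega (mapArgs h l) (hl.mapArgs h)

/-! ## Processes with values in `X` -/

/-- An `X`-process `(T, F)`. The set `T ⊆ A* ⊔ (A* × X)` is given by its two parts, the set of
traces and the set of `X`-traces; `F` is a set of failure pairs `(w, W)`, where `W` may be
infinite. -/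
@[ext]
structure XProc (A : Type u) (X : Type v) where
  traces : Set (List A)
  xtraces : Set (List A × X)
  failures : Set (List A × Set A)
  nil_mem : [] ∈ traces
  of_append : ∀ (w : List A) (a : A), w ++ [a] ∈ traces → w ∈ traces
  of_xtrace : ∀ (w : List A) (x : X), (w, x) ∈ xtraces → w ∈ traces
  of_failure : ∀ (w : List A) (W : Set A), (w, W) ∈ failures → w ∈ traces
  failure_mono : ∀ (w : List A) (V W : Set A), (w, W) ∈ failures → V ⊆ W → (w, V) ∈ failures
  failure_union : ∀ (w : List A) (V W : Set A), (w, W) ∈ failures →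
    (∀ a ∈ V, w ++ [a] ∉ traces) → (w, W ∪ V) ∈ failures

namespace XProc

variable {A : Type u} {X : Type v}

/-- Internal choice: componentwise union. -/
def inf (P Q : XProc A X) : XProc A X where
  traces := P.traces ∪ Q.traces
  xtraces := P.xtraces ∪ Q.xtraces
  failures := P.failures ∪ Q.failures
  nil_mem := Or.inl P.nil_mem
  of_append w a h := h.imp (P.of_append w a) (Q.of_append w a)
  of_xtrace w x h := h.imp (P.of_xtrace w x) (Q.of_xtrace w x)
  of_failure w W h := h.imp (P.of_failure w W) (Q.of_failure w W)
  failure_mono w V W h hV :=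
    h.imp (fun h => P.failure_mono w V W h hV) (fun h => Q.failure_mono w V W h hV)
  failure_union w V W h hV :=
    h.imp (fun h => P.failure_union w V W h fun a ha hw => hV a ha (Or.inl hw))
      (fun h => Q.failure_union w V W h fun a ha hw => hV a ha (Or.inr hw))

/-- The traces `{ε} ∪ {aᵢ w | w ∈ T_{Pᵢ}}` of an external choice. -/
def choiceTraces (l : List (A × XProc A X)) : Set (List A) :=
  {[]} ∪ {u | ∃ p ∈ l, ∃ w ∈ p.2.traces, u = p.1 :: w}

/-- The `X`-traces `{aᵢ w x | w x ∈ T_{Pᵢ}}` of an external choice. -/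
def choiceXtraces (l : List (A × XProc A X)) : Set (List A × X) :=
  {q | ∃ p ∈ l, ∃ w x, (w, x) ∈ p.2.xtraces ∧ q = (p.1 :: w, x)}

/-- The failure pairs `{(aᵢ w, W) | (w, W) ∈ F_{Pᵢ}}`. -/
def guardedFailures (l : List (A × XProc A X)) : Set (List A × Set A) :=
  {q | ∃ p ∈ l, ∃ w W, (w, W) ∈ p.2.failures ∧ q = (p.1 :: w, W)}

/-- The failure pairs `{(ε, W) | W ∩ {a₁, …, aₙ} = ∅}`. -/
def initialFailures (l : List (A × XProc A X)) : Set (List A × Set A) :=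
  {q | ∃ W : Set A, (∀ p ∈ l, p.1 ∉ W) ∧ q = ([], W)}

theorem choiceTraces_of_append (l : List (A × XProc A X)) (w : List A) (a : A)
    (h : w ++ [a] ∈ choiceTraces l) : w ∈ choiceTraces l := by
  rcases h with h | ⟨p, hp, v, hv, he⟩
  · simp at h
  · cases w with
    | nil => exact Or.inl rfl
    | cons b w =>
      simp only [List.cons_append, List.cons.injEq] at he
      obtain ⟨rfl, rfl⟩ := he
      exact Or.inr ⟨p, hp, w, p.2.of_append _ _ hv, rfl⟩

theorem choiceXtraces_of_xtrace (l : List (A × XProc A X)) (w : List A) (x : X)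
    (h : (w, x) ∈ choiceXtraces l) : w ∈ choiceTraces l := by
  obtain ⟨p, hp, v, y, hv, he⟩ := h
  simp only [Prod.mk.injEq] at he
  obtain ⟨rfl, rfl⟩ := he
  exact Or.inr ⟨p, hp, v, p.2.of_xtrace _ _ hv, rfl⟩

theorem guardedFailures_of_failure (l : List (A × XProc A X)) (w : List A) (W : Set A)
    (h : (w, W) ∈ guardedFailures l) : w ∈ choiceTraces l := by
  obtain ⟨p, hp, v, V, hv, he⟩ := h
  simp only [Prod.mk.injEq] at he
  obtain ⟨rfl, rfl⟩ := he
  exact Or.inr ⟨p, hp, v, p.2.of_failure _ _ hv, rfl⟩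

theorem guardedFailures_mono (l : List (A × XProc A X)) (w : List A) (V W : Set A)
    (h : (w, W) ∈ guardedFailures l) (hV : V ⊆ W) : (w, V) ∈ guardedFailures l := by
  obtain ⟨p, hp, v, U, hv, he⟩ := h
  simp only [Prod.mk.injEq] at he
  obtain ⟨rfl, rfl⟩ := he
  exact ⟨p, hp, v, V, p.2.failure_mono _ _ _ hv hV, rfl⟩

theorem guardedFailures_union (l : List (A × XProc A X)) (w : List A) (V W : Set A)
    (h : (w, W) ∈ guardedFailures l) (hV : ∀ a ∈ V, w ++ [a] ∉ choiceTraces l) :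
    (w, W ∪ V) ∈ guardedFailures l := by
  obtain ⟨p, hp, v, U, hv, he⟩ := h
  simp only [Prod.mk.injEq] at he
  obtain ⟨rfl, rfl⟩ := he
  exact ⟨p, hp, v, W ∪ V, p.2.failure_union _ _ _ hv
    (fun a ha hw => hV a ha (Or.inr ⟨p, hp, v ++ [a], hw, rfl⟩)), rfl⟩

/-- Deterministic external choice. -/
def det (l : List (A × XProc A X)) : XProc A X where
  traces := choiceTraces l
  xtraces := choiceXtraces l
  failures := initialFailures l ∪ guardedFailures l
  nil_mem := Or.inl rfl
  of_append := choiceTraces_of_append l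
  of_xtrace := choiceXtraces_of_xtrace l
  of_failure := by
    rintro w W (⟨V, _, he⟩ | h)
    · simp only [Prod.mk.injEq] at he
      exact Or.inl he.1
    · exact guardedFailures_of_failure l w W h
  failure_mono := by
    rintro w V W (⟨U, hU, he⟩ | h) hV
    · simp only [Prod.mk.injEq] at he
      obtain ⟨rfl, rfl⟩ := he
      exact Or.inl ⟨V, fun p hp hpV => hU p hp (hV hpV), rfl⟩
    · exact Or.inr (guardedFailures_mono l w V W h hV)
  failure_union := by
    rintro w V W (⟨U, hU, he⟩ | h) hV
    · simp only [Prod.mk.injEq] at he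
      obtain ⟨rfl, rfl⟩ := he
      refine Or.inl ⟨W ∪ V, fun p hp hpV => ?_, rfl⟩
      rcases hpV with hpW | hpV
      · exact hU p hp hpW
      · exact hV _ hpV (Or.inr ⟨p, hp, [], p.2.nil_mem, rfl⟩)
    · exact Or.inr (guardedFailures_union l w V W h hV)

/-- Deterministic external choice with a divergent summand. -/
def detOmega (l : List (A × XProc A X)) : XProc A X where
  traces := choiceTraces l
  xtraces := choiceXtraces l
  failures := guardedFailures l
  nil_mem := Or.inl rfl
  of_append := choiceTraces_of_append l
  of_xtrace := choiceXtraces_of_xtrace l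
  of_failure := guardedFailures_of_failure l
  failure_mono := guardedFailures_mono l
  failure_union := guardedFailures_union l

/-- The process with the single `X`-trace `x` and no failure pairs. -/
def unit (x : X) : XProc A X where
  traces := {[]}
  xtraces := {([], x)}
  failures := ∅
  nil_mem := rfl
  of_append w a h := by simp at h
  of_xtrace w y h := by simp_all
  of_failure w W h := h.elim
  failure_mono w V W h := h.elim
  failure_union w V W h := h.elim

/-- A process is finitary if it has finitely many traces and `X`-traces. -/
def Finitary (P : XProc A X) : Prop := P.traces.Finite ∧ P.xtraces.Finite

theorem Finitary.inf {P Q : XProc A X} (hP : P.Finitary) (hQ : Q.Finitary) :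
    (P.inf Q).Finitary :=
  ⟨hP.1.union hQ.1, hP.2.union hQ.2⟩

theorem finite_choiceTraces (l : List (A × XProc A X)) (h : ∀ p ∈ l, p.2.Finitary) :
    (choiceTraces l).Finite := by
  refine (Set.finite_singleton _).union ?_
  refine ((List.finite_toSet l).biUnion
    (t := fun p => (fun w => p.1 :: w) '' p.2.traces) fun p hp => (h p hp).1.image _).subset ?_
  rintro u ⟨p, hp, w, hw, rfl⟩
  exact Set.mem_biUnion (show p ∈ {x | x ∈ l} from hp) ⟨w, hw, rfl⟩

theorem finite_choiceXtraces (l : List (A × XProc A X)) (h : ∀ p ∈ l, p.2.Finitary) :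
    (choiceXtraces l).Finite := by
  refine ((List.finite_toSet l).biUnion
    (t := fun p => (fun q : List A × X => (p.1 :: q.1, q.2)) '' p.2.xtraces)
      fun p hp => (h p hp).2.image _).subset ?_
  rintro u ⟨p, hp, w, x, hw, rfl⟩
  exact Set.mem_biUnion (show p ∈ {x | x ∈ l} from hp) ⟨(w, x), hw, rfl⟩

theorem finitary_det (l : List (A × XProc A X)) (h : ∀ p ∈ l, p.2.Finitary) :
    (det l).Finitary :=
  ⟨finite_choiceTraces l h, finite_choiceXtraces l h⟩

theorem finitary_detOmega (l : List (A × XProc A X)) (h : ∀ p ∈ l, p.2.Finitary) :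
    (detOmega l).Finitary :=
  ⟨finite_choiceTraces l h, finite_choiceXtraces l h⟩

theorem finitary_unit (x : X) : (unit x : XProc A X).Finitary :=
  ⟨Set.finite_singleton _, Set.finite_singleton _⟩

end XProc

/-- The finitary `X`-processes. -/
abbrev FinProc (A : Type u) (X : Type v) : Type (max u v) :=
  {P : XProc A X // P.Finitary}

namespace FinProc

variable {A : Type u} {X : Type v}

theorem finitary_of_mem (l : List (A × FinProc A X)) :
    ∀ p ∈ mapArgs Subtype.val l, p.2.Finitary := by
  intro p hp
  obtain ⟨q, _, rfl⟩ := List.mem_map.1 hp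
  exact q.2.2

/-- The operations on finitary `X`-processes. -/
instance : Ops A (FinProc A X) where
  inf P Q := ⟨P.1.inf Q.1, P.2.inf Q.2⟩
  det l _ := ⟨XProc.det (mapArgs Subtype.val l), XProc.finitary_det _ (finitary_of_mem l)⟩
  detOmega l _ :=
    ⟨XProc.detOmega (mapArgs Subtype.val l), XProc.finitary_detOmega _ (finitary_of_mem l)⟩

/-- The unit `x ↦ ({ε, x}, ∅)`. -/
def unit (x : X) : FinProc A X := ⟨XProc.unit x, XProc.finitary_unit x⟩

end FinProc

end CSP

/-! The axioms hold for processes because membership in each component turns `⊓` into disjunction,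
even under the merging convention for repeated actions (`exists_mem_merge`); `⊑` is then reverse
inclusion.

For freeness, an arbitrary algebra is regarded as a meet-semilattice with top `Ω`. Absorption and
distributivity decompose external choices: `Ω □ □ᵢ aᵢ yᵢ` is the meet of the terms `Ω □ aᵢ yᵢ`
(`detOmega_eq`), and `□ᵢ aᵢ yᵢ` is the same meet together with the bare menu `□ᵢ aᵢ Ω` (`det_eq`).
Hence a map between algebras is a homomorphism once it respects `⊓`, `Ω`, the prefixes `Ω □ a y` and
the menus (`isHom_of_map`).

A finitary process is the meet of its observations: an `X`-trace, a trace, or a trace followed by a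
finite menu `S` whose complement can be refused. There are finitely many of these, and they recover
even infinite refusal sets, because only finitely many actions are possible after each trace
(`exists_accepts`). The extension of `f` is forced to be the meet of the corresponding elements of
`B`. That this meet is compatible with `⊓` is the delicate point: `P ⊓ Q` can accept menus that
neither `P` nor `Q` accepts. These extra menus impose no new constraint, since a menu may be
enlarged by any possible action (`le_preList_acc_of_subset`). Uniqueness follows from
`extend_unit_eq` and the fact that homomorphisms preserve finite meets of observations. -/

namespace CSP

universe u v w

/-! ### Merging of repeated actions -/

section Merge

variable {A : Type u} {B : Type v}

theorem Deterministic.of_cons {p : A × B} {l : List (A × B)} (h : Deterministic (p :: l)) :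
    Deterministic l :=
  (List.nodup_cons.1 h).2

theorem Deterministic.fst_notMem {p : A × B} {l : List (A × B)} (h : Deterministic (p :: l)) :
    p.1 ∉ l.map Prod.fst :=
  (List.nodup_cons.1 h).1

theorem Deterministic.perm {l m : List (A × B)} (h : Deterministic l) (hp : l.Perm m) :
    Deterministic m :=
  (hp.map Prod.fst).nodup_iff.1 h

theorem deterministic_singleton (p : A × B) : Deterministic [p] :=
  List.nodup_singleton _

/-- Determinism depends only on the sequence of actions. -/
theorem Deterministic.of_map_fst_eq {C : Type w} {l : List (A × B)} {m : List (A × C)}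
    (h : Deterministic l) (he : l.map Prod.fst = m.map Prod.fst) : Deterministic m := by
  unfold Deterministic at h ⊢
  rwa [← he]

variable [Ops A B]

open Classical in
theorem merge_cons_of_notMem (a : A) (y : B) (l : List (A × B)) (h : a ∉ l.map Prod.fst) :
    merge ((a, y) :: l) = (a, y) :: merge l := by
  have h1 : l.filter (fun p => p.1 = a) = [] := by
    rw [List.filter_eq_nil_iff]
    intro p hp hpa
    exact h (List.mem_map.2 ⟨p, hp, by simpa using hpa⟩)
  simp only [merge, List.map_cons, List.dedup_cons_of_notMem h, List.filter_cons, decide_true,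
    if_true, h1]
  congr 1
  refine List.map_congr_left fun b hb => ?_
  have hne : a ≠ b := by
    rintro rfl
    exact h (List.mem_dedup.1 hb)
  simp [hne]

theorem merge_of_deterministic (l : List (A × B)) (h : Deterministic l) : merge l = l := by
  induction l with
  | nil => simp [merge]
  | cons p l ih =>
    obtain ⟨a, y⟩ := p
    rw [merge_cons_of_notMem a y l h.fst_notMem, ih h.of_cons]

-- The one genuine repetition needed later: it turns the absorption axiom with a repeated action
-- into a statement about the argument `y ⊓ z`.
open Classical in
theorem merge_cons_cons (a : A) (y z : B) (l : List (A × B)) (h : Deterministic ((a, z) :: l)) :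
    merge ((a, y) :: (a, z) :: l) = (a, Ops.inf y z) :: l := by
  have h1 : l.filter (fun p => p.1 = a) = [] := by
    rw [List.filter_eq_nil_iff]
    intro p hp hpa
    exact h.fst_notMem (List.mem_map.2 ⟨p, hp, by simpa using hpa⟩)
  rw [← merge_of_deterministic l h.of_cons]
  have h2 : l = merge l := (merge_of_deterministic l h.of_cons).symm
  have h3 := h.fst_notMem
  rw [← h2]
  conv_rhs => rw [h2]
  simp only [merge, List.map_cons]
  rw [List.dedup_cons_of_mem (by simp), List.dedup_cons_of_notMem h3]
  simp only [List.map_cons, List.filter_cons, decide_true, if_true, h1]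
  congr 1
  refine List.map_congr_left fun b hb => ?_
  have hne : a ≠ b := by
    rintro rfl
    exact h3 (List.mem_dedup.1 hb)
  simp [hne]

theorem choice_of_deterministic (l : List (A × B)) (h : Deterministic l) :
    choice l = Ops.det l h := by
  simp only [choice, merge_of_deterministic l h]

theorem choiceOmega_of_deterministic (l : List (A × B)) (h : Deterministic l) :
    choiceOmega l = Ops.detOmega l h := by
  simp only [choiceOmega, merge_of_deterministic l h]

theorem mem_fst_merge (l : List (A × B)) (a : A) :
    a ∈ (merge l).map Prod.fst ↔ a ∈ l.map Prod.fst := by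
  classical
  have h : (merge l).map Prod.fst = (l.map Prod.fst).dedup := by
    simp only [merge, List.map_map]
    exact List.map_id _
  rw [h, List.mem_dedup]

/-- A property of elements that turns binary internal choices into disjunctions holds for one of
the guarded terms of `merge l` if and only if it holds for one of those of `l`. -/
theorem exists_mem_merge {p : B → Prop} (hp : ∀ x y : B, p (Ops.inf x y) ↔ p x ∨ p y)
    (l : List (A × B)) (a : A) :
    (∃ y, (a, y) ∈ merge l ∧ p y) ↔ ∃ y, (a, y) ∈ l ∧ p y := by
  classical
  have hfold : ∀ (ts : List B) (t : B), p (ts.foldl Ops.inf t) ↔ p t ∨ ∃ s ∈ ts, p s := by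
    intro ts
    induction ts with
    | nil => simp
    | cons s ts ih =>
      intro t
      simp only [List.foldl_cons, ih, hp, List.exists_mem_cons_iff, or_assoc]
  have hinfs : ∀ ts : List B, ts ≠ [] → (p (infs ts) ↔ ∃ s ∈ ts, p s) := by
    rintro (_ | ⟨t, ts⟩) h
    · exact (h rfl).elim
    · simp only [infs, hfold, List.exists_mem_cons_iff]
  have hne : ∀ z, (a, z) ∈ l → (l.filter fun q => q.1 = a).map Prod.snd ≠ [] := by
    intro z hz h
    have : z ∈ (l.filter fun q => q.1 = a).map Prod.snd :=
      List.mem_map.2 ⟨(a, z), List.mem_filter.2 ⟨hz, by simp⟩, rfl⟩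
    rw [h] at this
    exact List.not_mem_nil this
  constructor
  · rintro ⟨y, hy, hpy⟩
    simp only [merge, List.mem_map, Prod.mk.injEq] at hy
    obtain ⟨b, hb, rfl, rfl⟩ := hy
    obtain ⟨q, hq, rfl⟩ := List.mem_map.1 (List.mem_dedup.1 hb)
    obtain ⟨s, hs, hps⟩ := (hinfs _ (hne q.2 hq)).1 hpy
    simp only [List.mem_map, List.mem_filter, decide_eq_true_eq] at hs
    obtain ⟨r, ⟨hr, hra⟩, rfl⟩ := hs
    exact ⟨r.2, hra ▸ hr, hps⟩
  · rintro ⟨y, hy, hpy⟩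
    refine ⟨_, List.mem_map.2 ⟨a, List.mem_dedup.2 (List.mem_map.2 ⟨_, hy, rfl⟩), rfl⟩, ?_⟩
    refine (hinfs _ (hne y hy)).2 ⟨y, ?_, hpy⟩
    exact List.mem_map.2 ⟨(a, y), List.mem_filter.2 ⟨hy, by simp⟩, rfl⟩

end Merge

/-! ### Finitary processes satisfy the axioms -/

namespace FinProc

variable {A : Type u} {X : Type v}

theorem ext {P Q : FinProc A X} (ht : ∀ w, w ∈ P.1.traces ↔ w ∈ Q.1.traces)
    (hx : ∀ w x, (w, x) ∈ P.1.xtraces ↔ (w, x) ∈ Q.1.xtraces)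
    (hf : ∀ w W, (w, W) ∈ P.1.failures ↔ (w, W) ∈ Q.1.failures) : P = Q :=
  Subtype.ext (XProc.ext (Set.ext ht) (Set.ext fun q => hx q.1 q.2) (Set.ext fun q => hf q.1 q.2))

section Membership

variable (P Q : FinProc A X) (l : List (A × FinProc A X)) (hl : Deterministic l)

@[simp] theorem mem_traces_inf (w : List A) :
    w ∈ (Ops.inf P Q).1.traces ↔ w ∈ P.1.traces ∨ w ∈ Q.1.traces := Iff.rfl

@[simp] theorem mem_xtraces_inf (w : List A × X) :
    w ∈ (Ops.inf P Q).1.xtraces ↔ w ∈ P.1.xtraces ∨ w ∈ Q.1.xtraces := Iff.rfl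

@[simp] theorem mem_failures_inf (w : List A × Set A) :
    w ∈ (Ops.inf P Q).1.failures ↔ w ∈ P.1.failures ∨ w ∈ Q.1.failures := Iff.rfl

theorem mem_choiceTraces (u : List A) :
    u ∈ XProc.choiceTraces (mapArgs Subtype.val l) ↔
      u = [] ∨ ∃ a w, u = a :: w ∧ ∃ P, (a, P) ∈ l ∧ w ∈ P.1.traces := by
  simp only [XProc.choiceTraces, mapArgs, Set.mem_union, Set.mem_singleton_iff, Set.mem_ofPred_eq,
    List.mem_map]
  refine or_congr_right ⟨?_, ?_⟩
  · rintro ⟨_, ⟨p, hp, rfl⟩, w, hw, rfl⟩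
    exact ⟨_, _, rfl, p.2, hp, hw⟩
  · rintro ⟨a, w, rfl, P, hP, hw⟩
    exact ⟨_, ⟨(a, P), hP, rfl⟩, w, hw, rfl⟩

theorem mem_choiceXtraces (u : List A) (x : X) :
    (u, x) ∈ XProc.choiceXtraces (mapArgs Subtype.val l) ↔
      ∃ a w, u = a :: w ∧ ∃ P, (a, P) ∈ l ∧ (w, x) ∈ P.1.xtraces := by
  simp only [XProc.choiceXtraces, mapArgs, Set.mem_ofPred_eq, List.mem_map, Prod.mk.injEq]
  constructor
  · rintro ⟨_, ⟨p, hp, rfl⟩, w, _, hw, rfl, rfl⟩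
    exact ⟨_, _, rfl, p.2, hp, hw⟩
  · rintro ⟨a, w, rfl, P, hP, hw⟩
    exact ⟨_, ⟨(a, P), hP, rfl⟩, w, x, hw, rfl, rfl⟩

theorem mem_guardedFailures (u : List A) (W : Set A) :
    (u, W) ∈ XProc.guardedFailures (mapArgs Subtype.val l) ↔
      ∃ a w, u = a :: w ∧ ∃ P, (a, P) ∈ l ∧ (w, W) ∈ P.1.failures := by
  simp only [XProc.guardedFailures, mapArgs, Set.mem_ofPred_eq, List.mem_map, Prod.mk.injEq]
  constructor
  · rintro ⟨_, ⟨p, hp, rfl⟩, w, _, hw, rfl, rfl⟩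
    exact ⟨_, _, rfl, p.2, hp, hw⟩
  · rintro ⟨a, w, rfl, P, hP, hw⟩
    exact ⟨_, ⟨(a, P), hP, rfl⟩, w, W, hw, rfl, rfl⟩

theorem mem_initialFailures (u : List A) (W : Set A) :
    (u, W) ∈ XProc.initialFailures (mapArgs Subtype.val l) ↔
      u = [] ∧ ∀ a ∈ l.map Prod.fst, a ∉ W := by
  simp only [XProc.initialFailures, mapArgs, Set.mem_ofPred_eq, List.mem_map, Prod.mk.injEq]
  constructor
  · rintro ⟨_, hW, rfl, rfl⟩
    refine ⟨rfl, ?_⟩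
    rintro _ ⟨p, hp, rfl⟩
    exact hW _ ⟨p, hp, rfl⟩
  · rintro ⟨rfl, hW⟩
    refine ⟨W, ?_, rfl, rfl⟩
    rintro _ ⟨p, hp, rfl⟩
    exact hW _ ⟨p, hp, rfl⟩

theorem mem_traces_det (u : List A) : u ∈ (Ops.det l hl).1.traces ↔
    u = [] ∨ ∃ a w, u = a :: w ∧ ∃ P, (a, P) ∈ l ∧ w ∈ P.1.traces :=
  mem_choiceTraces l u

theorem mem_traces_detOmega (u : List A) : u ∈ (Ops.detOmega l hl).1.traces ↔
    u = [] ∨ ∃ a w, u = a :: w ∧ ∃ P, (a, P) ∈ l ∧ w ∈ P.1.traces :=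
  mem_choiceTraces l u

theorem mem_xtraces_det (u : List A) (x : X) : (u, x) ∈ (Ops.det l hl).1.xtraces ↔
    ∃ a w, u = a :: w ∧ ∃ P, (a, P) ∈ l ∧ (w, x) ∈ P.1.xtraces :=
  mem_choiceXtraces l u x

theorem mem_xtraces_detOmega (u : List A) (x : X) : (u, x) ∈ (Ops.detOmega l hl).1.xtraces ↔
    ∃ a w, u = a :: w ∧ ∃ P, (a, P) ∈ l ∧ (w, x) ∈ P.1.xtraces :=
  mem_choiceXtraces l u x

theorem mem_failures_det (u : List A) (W : Set A) : (u, W) ∈ (Ops.det l hl).1.failures ↔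
    (u = [] ∧ ∀ a ∈ l.map Prod.fst, a ∉ W) ∨
      ∃ a w, u = a :: w ∧ ∃ P, (a, P) ∈ l ∧ (w, W) ∈ P.1.failures :=
  or_congr (mem_initialFailures l u W) (mem_guardedFailures l u W)

theorem mem_failures_detOmega (u : List A) (W : Set A) :
    (u, W) ∈ (Ops.detOmega l hl).1.failures ↔
      ∃ a w, u = a :: w ∧ ∃ P, (a, P) ∈ l ∧ (w, W) ∈ P.1.failures :=
  mem_guardedFailures l u W

theorem mem_traces_choice (u : List A) : u ∈ (choice l).1.traces ↔
    u = [] ∨ ∃ a w, u = a :: w ∧ ∃ P, (a, P) ∈ l ∧ w ∈ P.1.traces := by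
  simp only [choice, mem_traces_det,
    fun a w => exists_mem_merge (p := fun P : FinProc A X => w ∈ P.1.traces)
      (fun _ _ => Iff.rfl) l a]

theorem mem_traces_choiceOmega (u : List A) : u ∈ (choiceOmega l).1.traces ↔
    u = [] ∨ ∃ a w, u = a :: w ∧ ∃ P, (a, P) ∈ l ∧ w ∈ P.1.traces := by
  simp only [choiceOmega, mem_traces_detOmega,
    fun a w => exists_mem_merge (p := fun P : FinProc A X => w ∈ P.1.traces)
      (fun _ _ => Iff.rfl) l a]

theorem mem_xtraces_choice (u : List A) (x : X) : (u, x) ∈ (choice l).1.xtraces ↔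
    ∃ a w, u = a :: w ∧ ∃ P, (a, P) ∈ l ∧ (w, x) ∈ P.1.xtraces := by
  simp only [choice, mem_xtraces_det,
    fun a w => exists_mem_merge (p := fun P : FinProc A X => (w, x) ∈ P.1.xtraces)
      (fun _ _ => Iff.rfl) l a]

theorem mem_xtraces_choiceOmega (u : List A) (x : X) : (u, x) ∈ (choiceOmega l).1.xtraces ↔
    ∃ a w, u = a :: w ∧ ∃ P, (a, P) ∈ l ∧ (w, x) ∈ P.1.xtraces := by
  simp only [choiceOmega, mem_xtraces_detOmega,
    fun a w => exists_mem_merge (p := fun P : FinProc A X => (w, x) ∈ P.1.xtraces)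
      (fun _ _ => Iff.rfl) l a]

theorem mem_failures_choice (u : List A) (W : Set A) : (u, W) ∈ (choice l).1.failures ↔
    (u = [] ∧ ∀ a ∈ l.map Prod.fst, a ∉ W) ∨
      ∃ a w, u = a :: w ∧ ∃ P, (a, P) ∈ l ∧ (w, W) ∈ P.1.failures := by
  simp only [choice, mem_failures_det, mem_fst_merge,
    fun a w => exists_mem_merge (p := fun P : FinProc A X => (w, W) ∈ P.1.failures)
      (fun _ _ => Iff.rfl) l a]

theorem mem_failures_choiceOmega (u : List A) (W : Set A) :
    (u, W) ∈ (choiceOmega l).1.failures ↔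
      ∃ a w, u = a :: w ∧ ∃ P, (a, P) ∈ l ∧ (w, W) ∈ P.1.failures := by
  simp only [choiceOmega, mem_failures_detOmega,
    fun a w => exists_mem_merge (p := fun P : FinProc A X => (w, W) ∈ P.1.failures)
      (fun _ _ => Iff.rfl) l a]

@[simp] theorem mem_traces_omega (u : List A) :
    u ∈ (omega : FinProc A X).1.traces ↔ u = [] := by
  simp [omega, mem_traces_detOmega]

@[simp] theorem mem_xtraces_omega (u : List A) (x : X) :
    (u, x) ∉ (omega : FinProc A X).1.xtraces := by
  simp [omega, mem_xtraces_detOmega]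

@[simp] theorem mem_failures_omega (u : List A) (W : Set A) :
    (u, W) ∉ (omega : FinProc A X).1.failures := by
  simp [omega, mem_failures_detOmega]

end Membership

/-- Internal choice is componentwise union, and a union equals its first member exactly when it adds
nothing. The absorption axioms thereby become inclusions. -/
theorem refines_iff (P Q : FinProc A X) : Refines P Q ↔
    (∀ w ∈ Q.1.traces, w ∈ P.1.traces) ∧ (∀ w x, (w, x) ∈ Q.1.xtraces → (w, x) ∈ P.1.xtraces) ∧
      ∀ w W, (w, W) ∈ Q.1.failures → (w, W) ∈ P.1.failures := by
  constructor
  · intro h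
    unfold Refines at h
    refine ⟨fun w hw => ?_, fun w x hw => ?_, fun w W hw => ?_⟩ <;> rw [← h] <;> exact Or.inr hw
  · rintro ⟨h1, h2, h3⟩
    exact ext (fun w => or_iff_left_of_imp (h1 w)) (fun w x => or_iff_left_of_imp (h2 w x))
      fun w W => or_iff_left_of_imp (h3 w W)

theorem exists_mem_cons_inf {p : FinProc A X → Prop}
    (hp : ∀ P Q : FinProc A X, p (Ops.inf P Q) ↔ p P ∨ p Q) (a b : A) (P Q : FinProc A X)
    (l : List (A × FinProc A X)) :
    (∃ R, (b, R) ∈ (a, Ops.inf P Q) :: l ∧ p R) ↔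
      (∃ R, (b, R) ∈ (a, P) :: l ∧ p R) ∨ ∃ R, (b, R) ∈ (a, Q) :: l ∧ p R := by
  simp only [List.mem_cons, Prod.mk.injEq, or_and_right, exists_or, and_assoc,
    exists_and_left, exists_eq_left, hp]
  tauto

theorem exists_cons_eq_or {p q r : A → List A → Prop} (h : ∀ a w, p a w ↔ q a w ∨ r a w)
    (u : List A) :
    (∃ a w, u = a :: w ∧ p a w) ↔ (∃ a w, u = a :: w ∧ q a w) ∨ ∃ a w, u = a :: w ∧ r a w := by
  simp only [h, and_or_left, exists_or]

instance isAlgebra : IsAlgebra A (FinProc A X) where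
  inf_assoc P Q R := ext (fun _ => or_assoc) (fun _ _ => or_assoc) fun _ _ => or_assoc
  inf_comm P Q := ext (fun _ => or_comm) (fun _ _ => or_comm) fun _ _ => or_comm
  inf_idem P := ext (fun _ => or_self_iff) (fun _ _ => or_self_iff) fun _ _ => or_self_iff
  inf_omega P := ext
    (fun w => or_iff_left_of_imp fun h => (mem_traces_omega w).1 h ▸ P.1.nil_mem)
    (fun w x => or_iff_left_of_imp fun h => (mem_xtraces_omega w x h).elim)
    fun w W => or_iff_left_of_imp fun h => (mem_failures_omega w W h).elim
  det_perm l m hl hm h := ext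
    (fun w => by simp only [mem_traces_det, h.mem_iff])
    (fun w x => by simp only [mem_xtraces_det, h.mem_iff])
    fun w W => by simp only [mem_failures_det, h.mem_iff, (h.map Prod.fst).mem_iff]
  detOmega_perm l m hl hm h := ext
    (fun w => by simp only [mem_traces_detOmega, h.mem_iff])
    (fun w x => by simp only [mem_xtraces_detOmega, h.mem_iff])
    fun w W => by simp only [mem_failures_detOmega, h.mem_iff]
  det_inf a P Q l h hx hy := by
    refine ext (fun u => ?_) (fun u x => ?_) fun u W => ?_
    · rw [mem_traces_inf, mem_traces_det, mem_traces_det, mem_traces_det,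
        exists_cons_eq_or fun b w => exists_mem_cons_inf (p := fun P => w ∈ P.1.traces)
          (fun _ _ => Iff.rfl) a b P Q l]
      exact or_or_distrib_left
    · rw [mem_xtraces_inf, mem_xtraces_det, mem_xtraces_det, mem_xtraces_det,
        exists_cons_eq_or fun b w => exists_mem_cons_inf (p := fun P => (w, x) ∈ P.1.xtraces)
          (fun _ _ => Iff.rfl) a b P Q l]
    · rw [mem_failures_inf, mem_failures_det, mem_failures_det, mem_failures_det,
        exists_cons_eq_or fun b w => exists_mem_cons_inf (p := fun P => (w, W) ∈ P.1.failures)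
          (fun _ _ => Iff.rfl) a b P Q l]
      -- The initial refusals depend only on the actions, so they are the same for all three
      -- choices.
      simp only [List.map_cons]
      exact or_or_distrib_left
  detOmega_inf a P Q l h hx hy := by
    refine ext (fun u => ?_) (fun u x => ?_) fun u W => ?_
    · rw [mem_traces_inf, mem_traces_detOmega, mem_traces_detOmega, mem_traces_detOmega,
        exists_cons_eq_or fun b w => exists_mem_cons_inf (p := fun P => w ∈ P.1.traces)
          (fun _ _ => Iff.rfl) a b P Q l]
      exact or_or_distrib_left
    · rw [mem_xtraces_inf, mem_xtraces_detOmega, mem_xtraces_detOmega, mem_xtraces_detOmega,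
        exists_cons_eq_or fun b w => exists_mem_cons_inf (p := fun P => (w, x) ∈ P.1.xtraces)
          (fun _ _ => Iff.rfl) a b P Q l]
    · rw [mem_failures_inf, mem_failures_detOmega, mem_failures_detOmega, mem_failures_detOmega,
        exists_cons_eq_or fun b w => exists_mem_cons_inf (p := fun P => (w, W) ∈ P.1.failures)
          (fun _ _ => Iff.rfl) a b P Q l]
  absorb_omega_omega l m b P := by
    simp only [refines_iff, mem_traces_inf, mem_xtraces_inf, mem_failures_inf,
      mem_traces_choiceOmega, mem_xtraces_choiceOmega, mem_failures_choiceOmega, List.mem_cons]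
    grind
  absorb_omega_det l m b P := by
    simp only [refines_iff, mem_traces_inf, mem_xtraces_inf, mem_failures_inf,
      mem_traces_choiceOmega, mem_xtraces_choiceOmega, mem_failures_choiceOmega,
      mem_traces_choice, mem_xtraces_choice, mem_failures_choice, List.mem_cons]
    grind
  absorb_det_omega l m b P := by
    simp only [refines_iff, mem_traces_inf, mem_xtraces_inf, mem_failures_inf,
      mem_traces_choiceOmega, mem_xtraces_choiceOmega, mem_failures_choiceOmega,
      mem_traces_choice, mem_xtraces_choice, mem_failures_choice, List.mem_cons, List.map_cons]
    -- A set avoiding `b` and the actions of `l` avoids those of `l` alone, so initial refusals on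
    -- the right already occur in `choice l`. Every other nonempty observation starts with a guarded
    -- term of `l` or with `(b, P)`.
    grind
  absorb_det_det l m b P := by
    simp only [refines_iff, mem_traces_inf, mem_xtraces_inf, mem_failures_inf,
      mem_traces_choice, mem_xtraces_choice, mem_failures_choice, List.mem_cons, List.map_cons]
    grind

end FinProc

/-! ## The semilattice of a `CSP(|,Ω)`-algebra -/

section Algebra

variable {A : Type u} {B : Type v} [Ops A B]

/-- The order `⊑`, with internal choice as infimum. -/
abbrev semilatticeInf (A : Type u) (B : Type v) [Ops A B] [IsAlgebra A B] : SemilatticeInf B where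
  le x y := Refines x y
  le_refl := IsAlgebra.inf_idem
  le_trans x y z hxy hyz := by
    unfold Refines at *
    rw [← hxy, IsAlgebra.inf_assoc, hyz]
  le_antisymm x y hxy hyx := by
    unfold Refines at *
    rw [← hxy, IsAlgebra.inf_comm, hyx]
  inf := Ops.inf
  inf_le_left x y := by
    unfold Refines
    rw [IsAlgebra.inf_comm, ← IsAlgebra.inf_assoc, IsAlgebra.inf_idem]
  inf_le_right x y := by
    unfold Refines
    rw [IsAlgebra.inf_assoc, IsAlgebra.inf_idem]
  le_inf x y z hxy hxz := by
    unfold Refines at *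
    rw [← IsAlgebra.inf_assoc, hxy, hxz]

attribute [local instance] semilatticeInf

/-- `Ω` is the greatest element. -/
abbrev orderTop (A : Type u) (B : Type v) [Ops A B] [IsAlgebra A B] : OrderTop B where
  top := omega
  le_top := IsAlgebra.inf_omega

attribute [local instance] orderTop

/-- The term `Ω □ a y`. -/
def pre (a : A) (y : B) : B := Ops.detOmega [(a, y)] (deterministic_singleton _)

theorem deterministic_acc (S : Finset A) :
    Deterministic (S.toList.map fun a => (a, (omega : B))) := by
  simpa [Deterministic, Function.comp_def] using S.nodup_toList

/-- The term `□_{a ∈ S} a Ω`. -/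
noncomputable def acc (S : Finset A) : B :=
  Ops.det (S.toList.map fun a => (a, omega)) (deterministic_acc S)

/-- The term `Ω □ a₁ (Ω □ a₂ (⋯ (Ω □ aₙ y)))`. -/
def preList (w : List A) (y : B) : B := w.foldr pre y

theorem preList_cons (a : A) (w : List A) (y : B) :
    preList (a :: w) y = pre a (preList w y) := rfl

theorem preList_append (w v : List A) (y : B) : preList (w ++ v) y = preList w (preList v y) :=
  List.foldr_append

variable [IsAlgebra A B]

theorem pre_inf (a : A) (x y : B) : pre a (x ⊓ y) = pre a x ⊓ pre a y :=
  IsAlgebra.detOmega_inf a x y [] _ _ _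

theorem pre_mono (a : A) {x y : B} (h : x ≤ y) : pre a x ≤ pre a y := by
  rw [← inf_eq_left, ← pre_inf, inf_eq_left.2 h]

theorem preList_mono (w : List A) {x y : B} (h : x ≤ y) : preList w x ≤ preList w y := by
  induction w with
  | nil => exact h
  | cons a w ih => exact pre_mono a ih

theorem preList_inf (w : List A) (x y : B) :
    preList w (x ⊓ y) = preList w x ⊓ preList w y := by
  induction w with
  | nil => rfl
  | cons a w ih => simp only [preList_cons, ih, pre_inf]

/-- Prefixing preserves nonempty finite meets, but `pre a ⊤` need not be `⊤`; the extra conjunct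
accounts for the empty meet. -/
theorem le_pre_finset_inf {ι : Type w} (a : A) (s : Finset ι) (g : ι → B) (c : B) :
    c ≤ pre a (s.inf g) ↔ c ≤ pre a ⊤ ∧ ∀ i ∈ s, c ≤ pre a (g i) := by
  classical
  induction s using Finset.induction_on with
  | empty => simp
  | insert i s _ ih =>
    rw [Finset.inf_insert, pre_inf, le_inf_iff, ih, Finset.forall_mem_insert]
    tauto

/-- Absorption with empty first choice: the left-hand side is `Ω ⊓ t`, and `Ω` is neutral. -/
theorem detOmega_le_pre (l : List (A × B)) (hl : Deterministic l) (p : A × B) (hp : p ∈ l) :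
    Ops.detOmega l hl ≤ pre p.1 p.2 := by
  obtain ⟨l₁, l₂, rfl⟩ := List.append_of_mem hp
  have hperm : (l₁ ++ p :: l₂).Perm (p :: (l₁ ++ l₂)) := List.perm_middle
  rw [IsAlgebra.detOmega_perm _ _ hl (hl.perm hperm) hperm]
  have h : choiceOmega [] ⊓ choiceOmega (p :: (l₁ ++ l₂)) ≤ choiceOmega [p] :=
    IsAlgebra.absorb_omega_omega [] (l₁ ++ l₂) p.1 p.2
  rw [choiceOmega_of_deterministic _ (hl.perm hperm),
    choiceOmega_of_deterministic _ (deterministic_singleton p),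
    choiceOmega_of_deterministic _ deterministic_nil] at h
  exact (le_inf le_top le_rfl).trans h

theorem det_le_pre (l : List (A × B)) (hl : Deterministic l) (p : A × B) (hp : p ∈ l) :
    Ops.det l hl ≤ pre p.1 p.2 := by
  obtain ⟨l₁, l₂, rfl⟩ := List.append_of_mem hp
  have hperm : (l₁ ++ p :: l₂).Perm (p :: (l₁ ++ l₂)) := List.perm_middle
  rw [IsAlgebra.det_perm _ _ hl (hl.perm hperm) hperm]
  have h : choiceOmega [] ⊓ choice (p :: (l₁ ++ l₂)) ≤ choiceOmega [p] :=
    IsAlgebra.absorb_omega_det [] (l₁ ++ l₂) p.1 p.2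
  rw [choice_of_deterministic _ (hl.perm hperm),
    choiceOmega_of_deterministic _ (deterministic_singleton p),
    choiceOmega_of_deterministic _ deterministic_nil] at h
  exact (le_inf le_top le_rfl).trans h

/-- The internal choice of the terms `Ω □ aᵢ yᵢ`. -/
def infPre {A : Type u} {B : Type v} [Ops A B] (l : List (A × B)) : B :=
  l.foldr (fun p b => Ops.inf (pre p.1 p.2) b) omega

theorem infPre_cons (p : A × B) (l : List (A × B)) :
    infPre (p :: l) = pre p.1 p.2 ⊓ infPre l := rfl

theorem le_infPre (l : List (A × B)) (c : B) :
    c ≤ infPre l ↔ ∀ p ∈ l, c ≤ pre p.1 p.2 := by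
  induction l with
  | nil => exact iff_of_true le_top fun _ hp => (List.not_mem_nil hp).elim
  | cons p l ih => rw [infPre_cons, le_inf_iff, ih, List.forall_mem_cons]

/-- Each summand is an upper bound by `detOmega_le_pre`. Conversely, absorption adjoins the guarded
terms one at a time. -/
theorem detOmega_eq (l : List (A × B)) (hl : Deterministic l) : Ops.detOmega l hl = infPre l := by
  refine le_antisymm ((le_infPre _ _).2 (detOmega_le_pre l hl)) ?_
  induction l with
  | nil => exact le_rfl
  | cons p l ih =>
    have h : choiceOmega l ⊓ choiceOmega [p] ≤ choiceOmega (p :: l) :=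
      IsAlgebra.absorb_omega_omega l [] p.1 p.2
    rw [choiceOmega_of_deterministic _ hl, choiceOmega_of_deterministic _ hl.of_cons,
      choiceOmega_of_deterministic _ (deterministic_singleton p)] at h
    refine le_trans ?_ h
    rw [infPre_cons, inf_comm]
    exact inf_le_inf_right _ (ih hl.of_cons)

/-- Since `y = y ⊓ Ω`, distributivity bounds the left side by the choice with continuation `Ω`. For
the converse, absorption adds a second summand `a y` next to `a Ω`, and merging the two gives back
`a (y ⊓ Ω)`. -/
theorem det_cons (a : A) (y : B) (l : List (A × B)) (hl : Deterministic ((a, y) :: l))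
    (ht : Deterministic ((a, ⊤) :: l)) :
    Ops.det ((a, y) :: l) hl = Ops.det ((a, ⊤) :: l) ht ⊓ pre a y := by
  have hd : Deterministic ((a, y ⊓ ⊤) :: l) := hl.of_map_fst_eq rfl
  have he : Ops.det ((a, y ⊓ ⊤) :: l) hd = Ops.det ((a, y) :: l) hl := by
    simp only [inf_top_eq]
  refine le_antisymm (le_inf ?_ (det_le_pre _ hl (a, y) List.mem_cons_self)) ?_
  · rw [← he]
    have h : Ops.det ((a, y ⊓ ⊤) :: l) hd = Ops.det ((a, y) :: l) hl ⊓ Ops.det ((a, ⊤) :: l) ht :=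
      IsAlgebra.det_inf a y ⊤ l hd hl ht
    rw [h]
    exact inf_le_right
  · have h : choice ((a, ⊤) :: l) ⊓ choiceOmega [(a, y)] ≤ choice ((a, y) :: (a, ⊤) :: l) :=
      IsAlgebra.absorb_det_omega ((a, ⊤) :: l) [] a y
    have hm : choice ((a, y) :: (a, ⊤) :: l) = Ops.det ((a, y ⊓ ⊤) :: l) hd := by
      unfold choice
      congr 1
      exact merge_cons_cons a y ⊤ l ht
    rwa [hm, he, choice_of_deterministic _ ht,
      choiceOmega_of_deterministic _ (deterministic_singleton _)] at h

theorem det_append (l r : List (A × B)) (h : Deterministic (l ++ r))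
    (ht : Deterministic (l.map (fun p => (p.1, (⊤ : B))) ++ r)) :
    Ops.det (l ++ r) h = Ops.det (l.map (fun p => (p.1, (⊤ : B))) ++ r) ht ⊓ infPre l := by
  induction l generalizing r with
  | nil => exact inf_top_eq _ |>.symm
  | cons p l ih =>
    -- The processed summand, now carrying `⊤`, is moved into `r`; this is why the induction
    -- generalizes `r`.
    obtain ⟨a, y⟩ := p
    have h1 : Deterministic ((a, (⊤ : B)) :: (l ++ r)) := h.of_map_fst_eq rfl
    have p1 : ((a, (⊤ : B)) :: (l ++ r)).Perm (l ++ (a, ⊤) :: r) := List.perm_middle.symm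
    have p2 : (l.map (fun p => (p.1, (⊤ : B))) ++ (a, ⊤) :: r).Perm
      ((a, ⊤) :: (l.map (fun p => (p.1, (⊤ : B))) ++ r)) := List.perm_middle
    have h2 := ht.perm p2.symm
    calc Ops.det ((a, y) :: (l ++ r)) h
        = Ops.det ((a, ⊤) :: (l ++ r)) h1 ⊓ pre a y := det_cons a y (l ++ r) h h1
      _ = Ops.det (l ++ (a, ⊤) :: r) (h1.perm p1) ⊓ pre a y := by
        rw [IsAlgebra.det_perm _ _ h1 (h1.perm p1) p1]
      _ = _ := by
        rw [ih ((a, ⊤) :: r) (h1.perm p1) h2, infPre_cons,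
          IsAlgebra.det_perm _ _ h2 ht p2, inf_assoc, inf_comm (pre a y)]

-- The menu separates from the continuations: all dependence on the arguments lies in `infPre`, and
-- all information about stability lies in `acc`.
open Classical in
theorem det_eq (l : List (A × B)) (hl : Deterministic l) :
    Ops.det l hl = acc (l.map Prod.fst).toFinset ⊓ infPre l := by
  have ht : Deterministic (l.map fun p => (p.1, (⊤ : B))) :=
    hl.of_map_fst_eq (by simp)
  have h1 : Ops.det l hl = Ops.det (l.map fun p => (p.1, (⊤ : B))) ht ⊓ infPre l := by
    have := det_append l [] (by simpa using hl) (by simpa using ht)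
    simpa only [List.append_nil] using this
  rw [h1]
  congr 1
  refine IsAlgebra.det_perm _ _ _ _ ?_
  have := (List.toFinset_toList hl).map fun a => (a, (⊤ : B))
  rw [List.map_map] at this
  exact this.symm

theorem acc_le_pre_top (S : Finset A) (a : A) (ha : a ∈ S) : (acc S : B) ≤ pre a ⊤ :=
  det_le_pre _ _ (a, ⊤) (List.mem_map.2 ⟨a, Finset.mem_toList.2 ha, rfl⟩)

-- For a new action `b` this is absorption of a choice with an `Ω`-summand into one without, all
-- continuations being `Ω`. It is the algebraic source of the enlargement of acceptance sets.
open Classical in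
theorem acc_inf_pre_top_le (S : Finset A) (b : A) :
    (acc S ⊓ pre b ⊤ : B) ≤ acc (insert b S) := by
  by_cases hb : b ∈ S
  · rw [Finset.insert_eq_of_mem hb]
    exact inf_le_left
  · have hperm : ((b, (⊤ : B)) :: S.toList.map fun a => (a, ⊤)).Perm
        ((insert b S).toList.map fun a => (a, ⊤)) :=
      ((Finset.toList_insert hb).map fun a => (a, (⊤ : B))).symm
    have hS : Deterministic (S.toList.map fun a => (a, (⊤ : B))) := deterministic_acc S
    have hi : Deterministic ((insert b S).toList.map fun a => (a, (⊤ : B))) := deterministic_acc _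
    have hd := hi.perm hperm.symm
    have h : choice (S.toList.map fun a => (a, (⊤ : B))) ⊓ choiceOmega [(b, ⊤)] ≤
        choice ((b, ⊤) :: S.toList.map fun a => (a, (⊤ : B))) :=
      IsAlgebra.absorb_det_omega _ [] b ⊤
    rw [choice_of_deterministic _ hS, choice_of_deterministic _ hd,
      choiceOmega_of_deterministic _ (deterministic_singleton _),
      IsAlgebra.det_perm _ _ hd hi hperm] at h
    exact h

/-- Enlarging an acceptance set by possible actions. -/
theorem le_preList_acc_of_subset (w : List A) (R S : Finset A) (hRS : R ⊆ S) (c : B)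
    (hc : c ≤ preList w (acc R)) (hS : ∀ a ∈ S, c ≤ preList (w ++ [a]) ⊤) :
    c ≤ preList w (acc S) := by
  classical
  -- The actions of `S` are adjoined to `R` one at a time.
  have key : ∀ U : Finset A, U ⊆ S → c ≤ preList w (acc (R ∪ U)) := by
    intro U
    induction U using Finset.induction_on with
    | empty => simpa using hc
    | insert b U _ ih =>
      intro hU
      obtain ⟨hb, hU⟩ := Finset.insert_subset_iff.1 hU
      rw [Finset.union_insert]
      refine le_trans ?_ (preList_mono w (acc_inf_pre_top_le (R ∪ U) b))
      rw [preList_inf]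
      have h := hS b hb
      rw [preList_append] at h
      exact le_inf (ih hU) h
  simpa [Finset.union_eq_right.2 hRS] using key S le_rfl

end Algebra

/-! ## Homomorphisms -/

section Hom

variable {A : Type u} {B : Type v} {C : Type w} [Ops A B] [Ops A C]

theorem infPre_mapArgs {h : B → C} (hinf : ∀ x y, h (Ops.inf x y) = Ops.inf (h x) (h y))
    (htop : h omega = omega) (hpre : ∀ a y, h (pre a y) = pre a (h y)) (l : List (A × B)) :
    h (infPre l) = infPre (mapArgs h l) := by
  induction l with
  | nil => exact htop
  | cons p l ih =>
    change h (Ops.inf (pre p.1 p.2) (infPre l)) = Ops.inf (pre p.1 (h p.2)) (infPre (mapArgs h l))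
    rw [hinf, hpre, ih]

/-- By `det_eq` and `detOmega_eq`, valid in both algebras, these four kinds of terms generate every
operation. -/
theorem isHom_of_map [IsAlgebra A B] [IsAlgebra A C] {h : B → C}
    (hinf : ∀ x y, h (Ops.inf x y) = Ops.inf (h x) (h y))
    (htop : h omega = omega) (hpre : ∀ a y, h (pre a y) = pre a (h y))
    (hacc : ∀ S : Finset A, h (acc S) = acc S) : IsHom (A := A) h where
  map_inf := hinf
  map_det l hl := by
    classical
    have hfst : (mapArgs h l).map Prod.fst = l.map Prod.fst := by simp [mapArgs]
    rw [det_eq, det_eq, hfst]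
    change h (Ops.inf (acc _) (infPre l)) = Ops.inf (acc _) (infPre _)
    rw [hinf, hacc, infPre_mapArgs hinf htop hpre]
  map_detOmega l hl := by
    rw [detOmega_eq, detOmega_eq, infPre_mapArgs hinf htop hpre]

theorem IsHom.map_omega {h : B → C} (hh : IsHom (A := A) h) : h omega = omega :=
  hh.map_detOmega [] _

theorem IsHom.map_preList {h : B → C} (hh : IsHom (A := A) h) (w : List A) (y : B) :
    h (preList w y) = preList w (h y) := by
  induction w with
  | nil => rfl
  | cons a w ih =>
    rw [preList_cons, preList_cons, ← ih]
    exact hh.map_detOmega [(a, preList w y)] _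

theorem IsHom.map_acc {h : B → C} (hh : IsHom (A := A) h) (S : Finset A) :
    h (acc S) = acc S := by
  unfold acc
  rw [hh.map_det]
  congr 1
  simp [mapArgs, hh.map_omega]

end Hom

-- Traces, failures and acceptance sets of the basic terms

attribute [local instance] semilatticeInf orderTop

namespace FinProc

variable {A : Type u} {X : Type v}

theorem le_iff (P Q : FinProc A X) : P ≤ Q ↔
    (∀ w ∈ Q.1.traces, w ∈ P.1.traces) ∧ (∀ w x, (w, x) ∈ Q.1.xtraces → (w, x) ∈ P.1.xtraces) ∧
      ∀ w W, (w, W) ∈ Q.1.failures → (w, W) ∈ P.1.failures :=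
  refines_iff P Q

theorem mem_traces_pre (a : A) (P : FinProc A X) (u : List A) :
    u ∈ (pre a P).1.traces ↔ u = [] ∨ ∃ w ∈ P.1.traces, u = a :: w := by
  simp only [pre, mem_traces_detOmega, List.mem_singleton, Prod.mk.injEq]
  grind

theorem mem_xtraces_pre (a : A) (P : FinProc A X) (u : List A) (x : X) :
    (u, x) ∈ (pre a P).1.xtraces ↔ ∃ w, (w, x) ∈ P.1.xtraces ∧ u = a :: w := by
  simp only [pre, mem_xtraces_detOmega, List.mem_singleton, Prod.mk.injEq]
  grind

theorem mem_failures_pre (a : A) (P : FinProc A X) (u : List A) (W : Set A) :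
    (u, W) ∈ (pre a P).1.failures ↔ ∃ w, (w, W) ∈ P.1.failures ∧ u = a :: w := by
  simp only [pre, mem_failures_detOmega, List.mem_singleton, Prod.mk.injEq]
  grind

theorem mem_traces_preList (w : List A) (P : FinProc A X) (u : List A) :
    u ∈ (preList w P).1.traces ↔ u <+: w ∨ ∃ v ∈ P.1.traces, u = w ++ v := by
  induction w generalizing u with
  | nil =>
    have := P.1.nil_mem
    simp only [preList, List.foldr_nil, List.prefix_nil, List.nil_append]
    grind
  | cons a w ih =>
    rw [preList_cons, mem_traces_pre]
    cases u with
    | nil => simp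
    | cons b u =>
      simp only [List.cons_prefix_cons, List.cons_append, List.cons.injEq, ih]
      grind

theorem mem_xtraces_preList (w : List A) (P : FinProc A X) (u : List A) (x : X) :
    (u, x) ∈ (preList w P).1.xtraces ↔ ∃ v, (v, x) ∈ P.1.xtraces ∧ u = w ++ v := by
  induction w generalizing u with
  | nil => simp [preList]
  | cons a w ih =>
    simp only [preList_cons, mem_xtraces_pre, ih, List.cons_append]
    grind

theorem mem_failures_preList (w : List A) (P : FinProc A X) (u : List A) (W : Set A) :
    (u, W) ∈ (preList w P).1.failures ↔ ∃ v, (v, W) ∈ P.1.failures ∧ u = w ++ v := by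
  induction w generalizing u with
  | nil => simp [preList]
  | cons a w ih =>
    simp only [preList_cons, mem_failures_pre, ih, List.cons_append]
    grind

theorem mem_traces_acc (S : Finset A) (u : List A) :
    u ∈ (acc S : FinProc A X).1.traces ↔ u = [] ∨ ∃ a ∈ S, u = [a] := by
  simp only [acc, mem_traces_det, List.mem_map, Finset.mem_toList, Prod.mk.injEq]
  refine or_congr_right ⟨?_, ?_⟩
  · rintro ⟨a, w, rfl, _, ⟨b, hb, rfl, rfl⟩, hw⟩
    rw [mem_traces_omega] at hw
    exact ⟨b, hb, by rw [hw]⟩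
  · rintro ⟨a, ha, rfl⟩
    exact ⟨a, [], rfl, _, ⟨a, ha, rfl, rfl⟩, (mem_traces_omega _).2 rfl⟩

theorem mem_xtraces_acc (S : Finset A) (u : List A) (x : X) :
    (u, x) ∉ (acc S : FinProc A X).1.xtraces := by
  simp only [acc, mem_xtraces_det, List.mem_map, Finset.mem_toList, Prod.mk.injEq]
  rintro ⟨a, w, rfl, _, ⟨b, hb, rfl, rfl⟩, hw⟩
  exact mem_xtraces_omega _ _ hw

theorem mem_failures_acc (S : Finset A) (u : List A) (W : Set A) :
    (u, W) ∈ (acc S : FinProc A X).1.failures ↔ u = [] ∧ ∀ a ∈ S, a ∉ W := by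
  simp only [acc, mem_failures_det, List.map_map, List.mem_map, Finset.mem_toList, Prod.mk.injEq,
    Function.comp_def, exists_eq_right]
  refine or_iff_left_of_imp ?_
  rintro ⟨a, w, rfl, _, ⟨b, hb, rfl, rfl⟩, hw⟩
  exact (mem_failures_omega _ _ hw).elim

theorem mem_traces_of_prefix (P : FinProc A X) {u w : List A} (h : u <+: w)
    (hw : w ∈ P.1.traces) : u ∈ P.1.traces := by
  obtain ⟨v, rfl⟩ := h
  induction v using List.reverseRecOn with
  | nil => simpa using hw
  | append_singleton v a ih =>
    rw [← List.append_assoc] at hw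
    exact ih (P.1.of_append _ _ hw)

theorem finite_initials (P : FinProc A X) (w : List A) : {a | w ++ [a] ∈ P.1.traces}.Finite :=
  P.2.1.preimage (f := fun a => w ++ [a]) (by intro a _ b _ h; simpa using h)

/-- After `w` the process may be stable and accept exactly the actions in `S`, or a subset. -/
def Accepts (P : FinProc A X) (w : List A) (S : Finset A) : Prop :=
  (w, (S : Set A)ᶜ) ∈ P.1.failures ∧ ∀ a ∈ S, w ++ [a] ∈ P.1.traces

theorem Accepts.mem_traces {P : FinProc A X} {w : List A} {S : Finset A} (h : P.Accepts w S) :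
    w ∈ P.1.traces :=
  P.1.of_failure _ _ h.1

/-- A refusal `W` may be enlarged by all impossible actions. What is left unrefused is a finite set
of possible actions, so finite acceptance sets encode arbitrary refusals. -/
theorem exists_accepts {P : FinProc A X} {w : List A} {W : Set A} (h : (w, W) ∈ P.1.failures) :
    ∃ S : Finset A, P.Accepts w S ∧ ∀ a, a ∈ S ↔ w ++ [a] ∈ P.1.traces ∧ a ∉ W := by
  have hfin : {a | w ++ [a] ∈ P.1.traces ∧ a ∉ W}.Finite :=
    (P.finite_initials w).subset fun a ha => ha.1
  have hmem : ∀ a, a ∈ hfin.toFinset ↔ w ++ [a] ∈ P.1.traces ∧ a ∉ W :=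
    fun a => hfin.mem_toFinset
  refine ⟨hfin.toFinset, ⟨?_, fun a ha => ((hmem a).1 ha).1⟩, hmem⟩
  refine P.1.failure_mono _ _ _
    (P.1.failure_union w {a | w ++ [a] ∉ P.1.traces} W h fun a ha => ha) ?_
  intro a ha
  by_cases haW : a ∈ W
  · exact Or.inl haW
  · exact Or.inr fun hw => ha ((hmem a).2 ⟨hw, haW⟩)

/-- There are finitely many traces, and the acceptance sets after each of them are subsets of a
finite set of possible actions. -/
theorem finite_accepts (P : FinProc A X) :
    {q : List A × Finset A | P.Accepts q.1 q.2}.Finite := by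
  classical
  refine (P.2.1.biUnion (t := fun w =>
    (fun S => (w, S)) '' ((P.finite_initials w).toFinset.powerset : Set (Finset A)))
    fun w _ => (Finset.finite_toSet _).image _).subset ?_
  rintro ⟨w, S⟩ h
  refine Set.mem_biUnion h.mem_traces ⟨S, ?_, rfl⟩
  rw [Finset.mem_coe, Finset.mem_powerset]
  intro a ha
  exact (P.finite_initials w).mem_toFinset.2 (h.2 a ha)

/-! ### The homomorphic extension -/

section Extend

variable {B : Type w} [Ops A B]

/-- The elements of an algebra that correspond to the observations of a process. -/
def observations (f : X → B) (P : FinProc A X) : Set B :=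
  (fun q : List A × X => preList q.1 (f q.2)) '' P.1.xtraces ∪
    (fun w => preList w omega) '' P.1.traces ∪
    (fun q : List A × Finset A => preList q.1 (acc q.2)) '' {q | P.Accepts q.1 q.2}

theorem finite_observations (f : X → B) (P : FinProc A X) : (P.observations f).Finite :=
  ((P.2.2.image _).union (P.2.1.image _)).union (P.finite_accepts.image _)

theorem forall_mem_observations {p : B → Prop} (f : X → B) (P : FinProc A X) :
    (∀ b ∈ P.observations f, p b) ↔
      (∀ w x, (w, x) ∈ P.1.xtraces → p (preList w (f x))) ∧
      (∀ w ∈ P.1.traces, p (preList w omega)) ∧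
      ∀ w S, P.Accepts w S → p (preList w (acc S)) := by
  simp only [observations, Set.mem_union, or_imp, forall_and, Set.forall_mem_image, Prod.forall,
    Set.mem_ofPred_eq, and_assoc]

variable [IsAlgebra A B]

/-- The homomorphic extension of `f`: the internal choice of all observations. -/
noncomputable def extend (f : X → B) (P : FinProc A X) : B :=
  (P.finite_observations f).toFinset.inf id

/-- The universal property of the meet; equations about `extend` are proved below by comparing lower
bounds. -/
theorem le_extend (f : X → B) (P : FinProc A X) (c : B) : c ≤ extend f P ↔
    (∀ w x, (w, x) ∈ P.1.xtraces → c ≤ preList w (f x)) ∧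
      (∀ w ∈ P.1.traces, c ≤ preList w ⊤) ∧
      ∀ w S, P.Accepts w S → c ≤ preList w (acc S) := by
  rw [extend, Finset.le_inf_iff]
  simp only [Set.Finite.mem_toFinset, id]
  exact forall_mem_observations f P

theorem le_pre_extend (f : X → B) (P : FinProc A X) (a : A) (c : B) : c ≤ pre a (extend f P) ↔
    (∀ w x, (w, x) ∈ P.1.xtraces → c ≤ preList (a :: w) (f x)) ∧
      (∀ w ∈ P.1.traces, c ≤ preList (a :: w) ⊤) ∧
      ∀ w S, P.Accepts w S → c ≤ preList (a :: w) (acc S) := by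
  rw [extend, le_pre_finset_inf]
  simp only [Set.Finite.mem_toFinset, id]
  refine (and_congr_right' (forall_mem_observations (p := fun b => c ≤ pre a b) f P)).trans ?_
  -- The conjunct `c ≤ pre a ⊤` is redundant: it is the bound for the empty trace, which every
  -- process has.
  exact and_iff_right_of_imp fun h => h.2.1 [] P.1.nil_mem

theorem extend_unit (f : X → B) (x : X) : extend f (unit x : FinProc A X) = f x := by
  refine eq_of_forall_le_iff fun c => (le_extend _ _ _).trans ⟨fun h => h.1 [] x rfl, fun h => ?_⟩
  refine ⟨fun w y hw => ?_, fun w hw => ?_, fun w S hS => hS.1.elim⟩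
  · obtain ⟨rfl, rfl⟩ : w = [] ∧ y = x := Prod.mk.inj hw
    exact h
  · obtain rfl : w = [] := hw
    exact le_top

theorem extend_omega (f : X → B) : extend f (omega : FinProc A X) = omega := by
  refine le_antisymm (le_top : _ ≤ (⊤ : B)) ((le_extend f _ ⊤).2 ⟨?_, ?_, ?_⟩)
  · exact fun w x h => (mem_xtraces_omega w x h).elim
  · intro w hw
    rw [mem_traces_omega] at hw
    rw [hw]
    exact le_rfl
  · exact fun w S h => (mem_failures_omega _ _ h.1).elim

theorem accepts_inf_left {P : FinProc A X} (Q : FinProc A X) {w : List A} {S : Finset A}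
    (h : P.Accepts w S) : Accepts (Ops.inf P Q) w S :=
  ⟨Or.inl h.1, fun a ha => Or.inl (h.2 a ha)⟩

theorem accepts_inf_right (P : FinProc A X) {Q : FinProc A X} {w : List A} {S : Finset A}
    (h : Q.Accepts w S) : Accepts (Ops.inf P Q) w S :=
  ⟨Or.inr h.1, fun a ha => Or.inr (h.2 a ha)⟩

/-- Here `S` may contain actions impossible for `P`, as happens when `P` is one side of an internal
choice. The part `R` of `S` that is possible for `P` is an acceptance set of `P`, and it is enlarged
to `S` by means of the trace bounds. -/
theorem le_preList_acc_of_failure (f : X → B) (P : FinProc A X) (w : List A) (S : Finset A) (c : B)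
    (hP : c ≤ extend f P) (h : (w, (S : Set A)ᶜ) ∈ P.1.failures)
    (hS : ∀ a ∈ S, c ≤ preList (w ++ [a]) ⊤) : c ≤ preList w (acc S) := by
  obtain ⟨R, hR, hRS⟩ := exists_accepts h
  refine le_preList_acc_of_subset w R S ?_ c (((le_extend f P c).1 hP).2.2 w R hR) hS
  intro a ha
  simpa using ((hRS a).1 ha).2

theorem extend_inf (f : X → B) (P Q : FinProc A X) :
    extend f (Ops.inf P Q) = Ops.inf (extend f P) (extend f Q) := by
  refine eq_of_forall_le_iff fun c => Iff.trans ?_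
    (show c ≤ extend f P ⊓ extend f Q ↔ _ from le_inf_iff).symm
  constructor
  · intro h
    obtain ⟨h1, h2, h3⟩ := (le_extend _ _ _).1 h
    exact ⟨(le_extend _ _ _).2 ⟨fun w x hw => h1 w x (Or.inl hw), fun w hw => h2 w (Or.inl hw),
        fun w S hS => h3 w S (accepts_inf_left Q hS)⟩,
      (le_extend _ _ _).2 ⟨fun w x hw => h1 w x (Or.inr hw), fun w hw => h2 w (Or.inr hw),
        fun w S hS => h3 w S (accepts_inf_right P hS)⟩⟩
  · rintro ⟨hP, hQ⟩
    have hP' := (le_extend _ _ _).1 hP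
    have hQ' := (le_extend _ _ _).1 hQ
    have ht : ∀ w ∈ (Ops.inf P Q).1.traces, c ≤ preList w ⊤ :=
      fun w hw => hw.elim (hP'.2.1 w) (hQ'.2.1 w)
    refine (le_extend _ _ _).2 ⟨fun w x hw => hw.elim (hP'.1 w x) (hQ'.1 w x), ht, ?_⟩
    rintro w S ⟨hF | hF, hS⟩
    · exact le_preList_acc_of_failure f P w S c hP hF fun a ha => ht _ (hS a ha)
    · exact le_preList_acc_of_failure f Q w S c hQ hF fun a ha => ht _ (hS a ha)

theorem accepts_pre (a : A) (P : FinProc A X) (u : List A) (S : Finset A) :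
    Accepts (pre a P) u S ↔ ∃ w, P.Accepts w S ∧ u = a :: w := by
  simp only [Accepts, mem_failures_pre, mem_traces_pre]
  constructor
  · rintro ⟨⟨w, hw, rfl⟩, h⟩
    refine ⟨w, ⟨hw, fun b hb => ?_⟩, rfl⟩
    simpa using h b hb
  · rintro ⟨w, ⟨hw, h⟩, rfl⟩
    exact ⟨⟨w, hw, rfl⟩, fun b hb => Or.inr ⟨_, h b hb, rfl⟩⟩

theorem extend_pre (f : X → B) (a : A) (P : FinProc A X) :
    extend f (pre a P) = pre a (extend f P) := by
  refine eq_of_forall_le_iff fun c => ?_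
  rw [le_extend, le_pre_extend]
  simp only [mem_traces_pre, mem_xtraces_pre, accepts_pre]
  constructor
  · rintro ⟨h1, h2, h3⟩
    exact ⟨fun w x hw => h1 _ x ⟨w, hw, rfl⟩, fun w hw => h2 _ (Or.inr ⟨w, hw, rfl⟩),
      fun w S hS => h3 _ S ⟨w, hS, rfl⟩⟩
  · rintro ⟨h1, h2, h3⟩
    refine ⟨?_, ?_, ?_⟩
    · rintro _ x ⟨w, hw, rfl⟩
      exact h1 w x hw
    · rintro _ (rfl | ⟨w, hw, rfl⟩)
      · exact le_top
      · exact h2 w hw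
    · rintro _ S ⟨w, hw, rfl⟩
      exact h3 w S hw

theorem extend_acc (f : X → B) (S : Finset A) : extend f (acc S : FinProc A X) = acc S := by
  have hS : ∀ a ∈ S, (acc S : B) ≤ preList ([] ++ [a]) ⊤ := acc_le_pre_top S
  refine eq_of_forall_le_iff fun c => (le_extend _ _ _).trans ⟨fun h => ?_, fun h => ?_⟩
  · refine h.2.2 [] S ⟨(mem_failures_acc _ _ _).2 ⟨rfl, fun a ha h => h ha⟩, fun a ha => ?_⟩
    exact (mem_traces_acc _ _).2 (Or.inr ⟨a, ha, rfl⟩)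
  · refine ⟨fun w x hw => (mem_xtraces_acc S w x hw).elim, fun w hw => ?_, ?_⟩
    · obtain rfl | ⟨a, ha, rfl⟩ := (mem_traces_acc _ _).1 hw
      · exact le_top
      · exact h.trans (hS a ha)
    · rintro w R ⟨hF, hR⟩
      obtain ⟨rfl, hSR⟩ := (mem_failures_acc _ _ _).1 hF
      -- The traces of `acc S` give `R ⊆ S`; the refusals in `hSR` give `S ⊆ R`.
      have hRS : ∀ a ∈ R, a ∈ S := by
        intro a ha
        obtain h | ⟨b, hb, h⟩ := (mem_traces_acc _ _).1 (hR a ha)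
        · simp at h
        · obtain rfl : a = b := by simpa using h
          exact hb
      refine le_preList_acc_of_subset [] S R (fun a ha => by simpa using hSR a ha) c h ?_
      exact fun a ha => h.trans (hS a (hRS a ha))

theorem isHom_extend (f : X → B) : IsHom (A := A) (extend f : FinProc A X → B) :=
  isHom_of_map (extend_inf f) (extend_omega f) (extend_pre f) (extend_acc f)

/-- Homomorphisms preserve the internal choice of observations. -/
theorem map_extend_of_isHom {C : Type*} [Ops A C] [IsAlgebra A C] {h : B → C}
    (hh : IsHom (A := A) h) (f : X → B) (P : FinProc A X) :
    h (extend f P) = extend (h ∘ f) P := by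
  -- The empty meet is `Ω`, which is itself an operation, so homomorphisms preserve all finite
  -- meets.
  have key : ∀ s : Finset B, h (s.inf id) = s.inf h := by
    classical
    intro s
    induction s using Finset.induction_on with
    | empty => exact hh.map_omega
    | insert b s _ ih =>
      rw [Finset.inf_insert, Finset.inf_insert, ← ih]
      exact hh.map_inf b _
  refine eq_of_forall_le_iff fun c => ?_
  rw [le_extend, extend, key, Finset.le_inf_iff]
  simp only [Set.Finite.mem_toFinset]
  rw [forall_mem_observations (p := fun b => c ≤ h b)]
  simp only [hh.map_preList, hh.map_acc, hh.map_omega]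
  rfl

end Extend

/-- Every finitary process is the internal choice of its observations. -/
theorem extend_unit_eq (P : FinProc A X) : extend unit P = P := by
  refine eq_of_forall_le_iff fun c => (le_extend _ _ _).trans ?_
  rw [le_iff]
  simp only [le_iff, mem_traces_preList, mem_xtraces_preList, mem_failures_preList]
  constructor
  · rintro ⟨h1, h2, h3⟩
    refine ⟨fun w hw => (h2 w hw).1 w (Or.inl List.prefix_rfl), fun w x hw => ?_, fun w W hw => ?_⟩
    · exact (h1 w x hw).2.1 w x ⟨[], rfl, by simp⟩
    · obtain ⟨S, hS, hSW⟩ := exists_accepts hw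
      refine (h3 w S hS).2.2 w W ⟨[], (mem_failures_acc _ _ _).2 ⟨rfl, ?_⟩, by simp⟩
      exact fun a ha => ((hSW a).1 ha).2
  · rintro ⟨h1, h2, h3⟩
    have hpre : ∀ {u w : List A}, w ∈ P.1.traces → u <+: w → u ∈ c.1.traces :=
      fun hw hu => h1 _ (P.mem_traces_of_prefix hu hw)
    refine ⟨fun w x hw => ⟨?_, ?_, ?_⟩, fun w hw => ⟨?_, ?_, ?_⟩, fun w S hS => ⟨?_, ?_, ?_⟩⟩
    · rintro u (hu | ⟨v, hv, rfl⟩)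
      · exact hpre (P.1.of_xtrace _ _ hw) hu
      · obtain rfl : v = [] := hv
        exact hpre (P.1.of_xtrace _ _ hw) (by simp)
    · rintro u y ⟨v, hv, rfl⟩
      obtain ⟨rfl, rfl⟩ : v = [] ∧ y = x := Prod.mk.inj hv
      simpa using h2 w y hw
    · rintro u W ⟨v, hv, rfl⟩
      exact hv.elim
    · rintro u (hu | ⟨v, hv, rfl⟩)
      · exact hpre hw hu
      · obtain rfl := (mem_traces_omega _).1 hv
        exact hpre hw (by simp)
    · rintro u y ⟨v, hv, rfl⟩
      exact (mem_xtraces_omega _ _ hv).elim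
    · rintro u W ⟨v, hv, rfl⟩
      exact (mem_failures_omega _ _ hv).elim
    · rintro u (hu | ⟨v, hv, rfl⟩)
      · exact hpre hS.mem_traces hu
      · obtain rfl | ⟨a, ha, rfl⟩ := (mem_traces_acc _ _).1 hv
        · exact hpre hS.mem_traces (by simp)
        · exact h1 _ (hS.2 a ha)
    · rintro u y ⟨v, hv, rfl⟩
      exact (mem_xtraces_acc _ _ _ hv).elim
    · rintro u W ⟨v, hv, rfl⟩
      obtain ⟨rfl, hW⟩ := (mem_failures_acc _ _ _).1 hv
      rw [List.append_nil]
      -- A refusal of `acc S` is disjoint from `S`, hence contained in the refusal `Sᶜ` already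
      -- present in `P`.
      exact h3 _ _ (P.1.failure_mono _ _ _ hS.1 fun a ha haS => hW a haS ha)

end FinProc

end CSP

/-! ### Freeness -/

theorem mainTheorem1 (A : Type*) (X : Type*) :
    CSP.IsAlgebra A (CSP.FinProc A X) ∧
      ∀ (B : Type*) [CSP.Ops A B] [CSP.IsAlgebra A B] (f : X → B),
        ∃! h : CSP.FinProc A X → B,
          CSP.IsHom h ∧ ∀ x : X, h (CSP.FinProc.unit x) = f x := by
  refine ⟨inferInstance, fun B _ _ f => ⟨CSP.FinProc.extend f,
    ⟨CSP.FinProc.isHom_extend f, CSP.FinProc.extend_unit f⟩, ?_⟩⟩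
  rintro h ⟨hh, hf⟩
  funext P
  -- With `f` written as `h ∘ unit` and `P` as the meet of its observations over `unit`, the value
  -- `h P` is forced.
  rw [← funext hf]
  conv_lhs => rw [← CSP.FinProc.extend_unit_eq P]
  exact CSP.FinProc.map_extend_of_isHom hh _ P
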